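/- Let $f>a>0$ be fixed integers. For nonnegative integers $l_0,l_2,g_0,g_1$ put $$c(l_0,l_2,g_0,g_1)=\frac{l_0}{f+g_0+g_1}+\frac{a(g_0+l_2)}{(f+g_0+g_1)f}.$$ For an integer $D>f$ define $$\tilde{\mathcal E}_D=\sum_{(l_0,l_2,g_0,g_1)\in\Xi_D} c(l_0,l_2,g_0,g_1)\sum_{s=\max(0,D-2f+a)}^{D-f-1}\frac{\binom{D-f}{s}}{\binom{D-a-1}{D-f-1}}\cdot\frac{\binom{f-a-1}{D-f-s-1}\binom{s}{n_1}\binom{D-f-s}{n_2}\binom{D-f-s}{n_3}\binom{f-a-(D-f-s)}{n_4}\binom{a-1}{a-l_1-l_2}}{\binom{D-1}{a}},$$ where $l_1=a-l_0-l_2$, $n_2=D-f-s-g_1$, $n_1=g_0-n_2$, $n_3=l_2-g_0+n_2$, $n_4=l_1-n_2$, binomial coefficients with a negative lower index are $0$, and $\Xi_D$ is the set of quadruples $(l_0,l_2,g_0,g_1)$ of nonnegative integers for which there are nonnegative integers $l_1,g_2,h_0,h_1,h_2$ with $$l_0+l_1+l_2=l_0+g_0+h_0=a,\qquad g_0+g_1+g_2=l_2+g_2+h_2=D-f,\qquad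 h_0+h_1+h_2=l_1+g_1+h_1=f-a.$$ For $D=f$, where the weights above degenerate, put $\tilde{\mathcal E}_f=\frac{a(a-1)}{f(f-1)}$; this is the expectation of $l_0/f$, where $l_0$ is the number of pairs of consecutive points $(O,O)$ in a uniformly random circular arrangement of $a$ points $O$ and $f-a$ points $\times$. Then $\tilde{\mathcal E}_{D+1}>\tilde{\mathcal E}_D$ for every integer $D\ge f$. -/

import Mathlib

noncomputable section

namespace CMinHash

/-- Binomial coefficient with integer arguments, as a real number, with the usual convention that
it vanishes when the lower index is negative (or exceeds the upper one). In every term below the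
upper index is nonnegative. -/
def binom (n k : ℤ) : ℝ :=
  if 0 ≤ n ∧ 0 ≤ k then (n.toNat.choose k.toNat : ℝ) else 0

/-- The intrinsic constraints on the numbers of consecutive pairs in a circular arrangement of
`a` points `O`, `f - a` points `×` and `D - f` points `-`: `l₀, l₁, l₂` count the pairs
`(O,O), (O,×), (O,-)`, `g₀, g₁, g₂` count `(-,O), (-,×), (-,-)` and
`h₀, h₁, h₂` count `(×,O), (×,×), (×,-)`. -/
structure Constraints (D f a l₀ l₁ l₂ g₀ g₁ g₂ h₀ h₁ h₂ : ℕ) : Prop where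
  rowO : l₀ + l₁ + l₂ = a
  colO : l₀ + g₀ + h₀ = a
  rowDash : g₀ + g₁ + g₂ = D - f
  colDash : l₂ + g₂ + h₂ = D - f
  rowCross : h₀ + h₁ + h₂ = f - a
  colCross : l₁ + g₁ + h₁ = f - a

open Classical in
/-- The feasible set of quadruples `(l₀, l₂, g₀, g₁)`: those that extend to nonnegative integers
satisfying the intrinsic constraints. The box only makes the set visibly finite, see
`mem_feasible`. -/
def feasible (D f a : ℕ) : Finset (ℕ × ℕ × ℕ × ℕ) :=
  (Finset.range (a + 1) ×ˢ Finset.range (a + 1) ×ˢ Finset.range (a + 1) ×ˢ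
    Finset.range (f - a + 1)).filter
    fun p => ∃ l₁ g₂ h₀ h₁ h₂ : ℕ,
      Constraints D f a p.1 l₁ p.2.1 p.2.2.1 p.2.2.2 g₂ h₀ h₁ h₂

theorem mem_feasible {D f a l₀ l₂ g₀ g₁ : ℕ} :
    (l₀, l₂, g₀, g₁) ∈ feasible D f a ↔
      ∃ l₁ g₂ h₀ h₁ h₂ : ℕ, Constraints D f a l₀ l₁ l₂ g₀ g₁ g₂ h₀ h₁ h₂ := by
  unfold feasible
  simp only [Finset.mem_filter, Finset.mem_product, Finset.mem_range, and_iff_right_iff_imp]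
  rintro ⟨l₁, g₂, h₀, h₁, h₂, h⟩
  obtain ⟨e1, e2, e3, e4, e5, e6⟩ := h
  omega

/-- The `s`-th summand of the joint weight of `(l₀, l₂, g₀, g₁)`. All arguments are integers, so
that every subtraction is the true one. -/
def term (D f a l₀ l₂ g₀ g₁ s : ℤ) : ℝ :=
  let l₁ := a - l₀ - l₂
  let n₁ := g₀ - (D - f - s - g₁)
  let n₂ := D - f - s - g₁
  let n₃ := l₂ - g₀ + (D - f - s - g₁)
  let n₄ := l₁ - (D - f - s - g₁)
  binom (D - f) s / binom (D - a - 1) (D - f - 1) *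
    (binom (f - a - 1) (D - f - s - 1) * binom s n₁ * binom (D - f - s) n₂ *
      binom (D - f - s) n₃ * binom (f - a - (D - f - s)) n₄ * binom (a - 1) (a - l₁ - l₂) /
      binom (D - 1) a)

/-- The inner sum over `s`, from `max (0, D - 2f + a)` to `D - f - 1`. -/
def weight (D f a l₀ l₂ g₀ g₁ : ℤ) : ℝ :=
  ∑ s ∈ Finset.Icc (max 0 (D - 2 * f + a)) (D - f - 1), term D f a l₀ l₂ g₀ g₁ s

/-- The probability that two hashes both collide, given the pair counts `l₀, l₂, g₀, g₁`. -/
def collision (f a l₀ l₂ g₀ g₁ : ℝ) : ℝ :=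
  l₀ / (f + g₀ + g₁) + a * (g₀ + l₂) / ((f + g₀ + g₁) * f)

/-- The quantity `Ẽ` in dimension `D`, for data with union size `f` and intersection size `a`.
For `D > f` it is the double sum over the feasible set and over `s`. For `D = f` there are no
`-` points, the expression for the weights degenerates (it has the lower index `-1`), and `Ẽ` is
the expectation of `l₀ / f` for `l₀` hypergeometric with population `f - 1`, `a` marked elements
and `a - 1` draws, that is `a (a - 1) / (f (f - 1))`. -/
def Etilde (f a D : ℕ) : ℝ :=
  if D = f then (a : ℝ) * (a - 1) / (f * (f - 1))
  else ∑ p ∈ feasible D f a,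
    collision f a p.1 p.2.1 p.2.2.1 p.2.2.2 * weight D f a p.1 p.2.1 p.2.2.1 p.2.2.2

end CMinHash

end

/-!
The proof is probabilistic in content. The double sum is the expectation of `collision` over a
uniformly random circular arrangement of `a` points `O`, `f - a` points `×` and `D - f` points `-`.
Its denominator `f + g₀ + g₁` depends only on the number `k = g₀ + g₁` of runs of `-`. Given `k`,
the other `f` points are in uniformly random circular order and the runs sit in a random `k`-subset
of their `f` gaps, so that the conditional expectation of `collision` has a closed form
`condCollision f a k`, and a one-line computation shows that it is strictly increasing in `k`
(`condCollision_add_one_sub`). The value at `k = 0` is the value prescribed for `D = f`.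

The number of runs satisfies a Markov recursion (`sum_runProb_succ`): a further `-` is inserted in
one of the `D` gaps of the arrangement, which creates a new run for `f - k` of them and leaves the
number of runs unchanged for the others. Hence `D (Ẽ_{D+1} - Ẽ_D)` is the expectation of
`(f - k) (condCollision f a (k + 1) - condCollision f a k)`, which is positive
(`Etilde_succ_sub`).

What remains is to derive the conditional form `Etilde_eq_sum_runProb` from the explicit weights,
by algebra. With `m = D - f - s`, the nonzero summands are parametrized by `m` and
`n₁, n₂, n₃, n₄, l₀` with `n₁ + n₂ + n₃ + n₄ + l₀ = a`, and `k = m + n₁` (`sum_feasible`). For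
fixed `m` and `n₁`, summing over the other variables is a weighted Vandermonde convolution
(`sum_vandermonde_weighted`). For fixed `k`, the remaining sum over `m + n₁ = k` is evaluated by
Nanjundiah's identity for products of binomial coefficients (`sum_choose_nanjundiah`,
`sum_choose_weighted`).
-/

namespace CMinHash

open Finset PowerSeries

/-! ### Nanjundiah's identity -/

theorem mk_choose (p : ℕ) :
    (PowerSeries.mk fun k => (p.choose k : ℝ)) = (1 + X) ^ p := by
  ext k
  rw [coeff_mk, ← Polynomial.coe_X, ← Polynomial.coe_one, ← Polynomial.coe_add,
    ← Polynomial.coe_pow, Polynomial.coeff_coe, Polynomial.coeff_one_add_X_pow]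

/-- The generating function of `k ↦ M.choose k * k.choose r`: the `r`-th divided derivative of
`(1 + X) ^ M`, times `X ^ r`. -/
theorem mk_choose_mul_choose (M r : ℕ) :
    (PowerSeries.mk fun k => ((M.choose k * k.choose r : ℕ) : ℝ)) =
      C (M.choose r : ℝ) * (X ^ r * (1 + X) ^ (M - r)) := by
  ext k
  rw [coeff_mk, coeff_C_mul, coeff_X_pow_mul', ← mk_choose, coeff_mk]
  split_ifs with h
  · exact_mod_cast Nat.choose_mul h
  · rw [Nat.choose_eq_zero_of_lt (not_le.1 h)]; simp

theorem mk_mul_choose (p : ℕ) :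
    (PowerSeries.mk fun k => (k : ℝ) * (p.choose k : ℝ)) =
      C (p : ℝ) * (X * (1 + X) ^ (p - 1)) := by
  have h := mk_choose_mul_choose p 1
  simp only [Nat.choose_one_right, pow_one] at h
  rw [← h]
  congr 1; funext k; push_cast; ring

theorem sum_choose_mul_choose_mul_choose (M N r q : ℕ) :
    ∑ p ∈ antidiagonal (r + q), M.choose p.1 * p.1.choose r * N.choose p.2 =
      M.choose r * (M - r + N).choose q := by
  have h : coeff (r + q) ((PowerSeries.mk fun k => ((M.choose k * k.choose r : ℕ) : ℝ)) *
      (PowerSeries.mk fun k => (N.choose k : ℝ))) = (M.choose r * (M - r + N).choose q : ℝ) := by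
    rw [mk_choose_mul_choose, mk_choose, mul_assoc, mul_assoc, ← pow_add, coeff_C_mul,
      add_comm r q, coeff_X_pow_mul, ← mk_choose, coeff_mk]
  rw [coeff_mul] at h
  simp only [coeff_mk] at h
  exact_mod_cast h

/-- Vandermonde's convolution, with the sum cut off at `n`: the omitted terms have lower index
`p.1 > n ≥ i`, and vanish. -/
theorem add_choose_add_eq_sum (x i n m : ℕ) (hi : i ≤ n) :
    (x + i).choose (m + n) = ∑ p ∈ antidiagonal n, i.choose p.1 * x.choose (m + p.2) := by
  rw [add_comm x i, Nat.add_choose_eq, Nat.sum_antidiagonal_eq_sum_range_succ_mk,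
    Nat.sum_antidiagonal_eq_sum_range_succ_mk]
  symm
  trans ∑ k ∈ range n.succ, i.choose k * x.choose (m + n - k)
  · refine sum_congr rfl fun k hk => ?_
    rw [Nat.add_sub_assoc (by simpa [Nat.lt_succ_iff] using hk)]
  · refine sum_subset (fun k hk => ?_) fun k _ hk => ?_
    · simp only [mem_range] at hk ⊢; omega
    · simp only [mem_range] at hk
      rw [Nat.choose_eq_zero_of_lt (by omega), zero_mul]

/-- Nanjundiah's identity. The last factor on the left is expanded by Vandermonde, the inner sum
over `p` is then a Vandermonde convolution, and so is the outer sum after the factor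
`(M + t + c).choose (M + t)` has been split off. -/
theorem sum_choose_nanjundiah (M t n c : ℕ) :
    ∑ p ∈ antidiagonal n,
        M.choose p.1 * (n + t).choose p.2 * (M + t + c + p.1).choose (M + t + n) =
      (M + t + c).choose (M + t) * (M + c).choose n := by
  calc _ = ∑ p ∈ antidiagonal n, ∑ q ∈ antidiagonal n, (M + t + c).choose (M + t + q.2) *
        (M.choose p.1 * p.1.choose q.1 * (n + t).choose p.2) := by
        refine sum_congr rfl fun p hp => ?_
        rw [add_choose_add_eq_sum _ _ _ _ (by have := mem_antidiagonal.1 hp; omega), mul_sum]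
        exact sum_congr rfl fun q _ => by ring
    _ = ∑ q ∈ antidiagonal n, (M + t + c).choose (M + t) * (M.choose q.1 * c.choose q.2) := by
        rw [sum_comm]
        refine sum_congr rfl fun q hq => ?_
        obtain ⟨r, u⟩ := q
        obtain rfl : r + u = n := by simpa using hq
        rw [← mul_sum, sum_choose_mul_choose_mul_choose]
        by_cases hr : r ≤ M
        · rw [show M - r + (r + u + t) = M + t + u by omega]
          have h := Nat.choose_mul (n := M + t + c) (k := M + t + u) (s := M + t)
            (by omega)
          rw [show M + t + c - (M + t) = c by omega, show M + t + u - (M + t) = u by omega,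
            Nat.choose_symm_add (a := M + t) (b := u)] at h
          dsimp only
          linear_combination M.choose r * h
        · simp [Nat.choose_eq_zero_of_lt (not_le.1 hr)]
    _ = _ := by rw [← mul_sum, Nat.add_choose_eq M c n]

/-! ### Summation over the pair counts at a fixed number of runs -/

theorem sum_antidiagonal_four (α β γ δ : ℕ → ℝ) (r : ℕ) :
    ∑ p ∈ antidiagonal r, ∑ q ∈ antidiagonal p.2, ∑ w ∈ antidiagonal q.2,
        α p.1 * (β q.1 * (γ w.1 * δ w.2)) =
      coeff r (PowerSeries.mk α * (PowerSeries.mk β * (PowerSeries.mk γ * PowerSeries.mk δ))) := by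
  simp only [coeff_mul, coeff_mk, mul_sum]

theorem coeff_one_add_X_pow_symm {r e d F : ℕ} (h : r + e = F) (hd : d = e) :
    coeff r ((1 + X : ℝ⟦X⟧) ^ F) = (F.choose d : ℝ) := by
  subst h hd
  rw [← mk_choose, coeff_mk, Nat.choose_symm_add]

/-- The complementary lower index `d` gives one formula for all `r`: at `r = 0` it exceeds `F`. -/
theorem coeff_X_mul_one_add_X_pow {r d F : ℕ} (h : r + d = F + 1) :
    coeff r (X * (1 + X : ℝ⟦X⟧) ^ F) = (F.choose d : ℝ) := by
  cases r with
  | zero => rw [coeff_zero_X_mul, Nat.choose_eq_zero_of_lt (by omega), Nat.cast_zero]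
  | succ r => rw [coeff_succ_X_mul, coeff_one_add_X_pow_symm (e := d) (by omega) rfl]

/-- The sum over `n₂, n₃, n₄, l₀` with `n₂ + n₃ + n₄ + l₀ = R`, for `m = i + 1` and
`j = n₁`. The second factor is the numerator of `collision`, for `c = a / f`. All binomial
coefficients on the right have the complementary lower index `b + i + j`, which depends on `i` and
`j` only through the number `i + j + 1` of runs; they vanish for `j > A + 1`. -/
theorem sum_vandermonde_weighted (A b i j R : ℕ) (c : ℝ) (hi : i + 1 ≤ b) (hj : j + R = A + 1) :
    ∑ p ∈ antidiagonal R, ∑ q ∈ antidiagonal p.2, ∑ w ∈ antidiagonal q.2,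
        ((i + 1).choose p.1 : ℝ) * (i + 1).choose q.1 * (b - (i + 1)).choose w.1 * A.choose w.2 *
          (w.2 + c * (2 * j + p.1 + q.1)) =
      A * (A + b + i).choose (b + i + j) +
        c * (2 * j * (A + 1 + b + i).choose (b + i + j) +
          2 * (i + 1) * (A + b + i).choose (b + i + j)) := by
  obtain ⟨e, rfl⟩ := Nat.exists_eq_add_of_le hi
  rw [Nat.add_sub_cancel_left]
  set β : ℕ → ℝ := fun k => ((i + 1).choose k : ℝ)
  set γ : ℕ → ℝ := fun k => (e.choose k : ℝ)
  set δ : ℕ → ℝ := fun k => (A.choose k : ℝ)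
  have h0 := sum_antidiagonal_four β β γ δ R
  have h1 := sum_antidiagonal_four (fun k => k * β k) β γ δ R
  have h2 := sum_antidiagonal_four β (fun k => k * β k) γ δ R
  have h3 := sum_antidiagonal_four β β γ (fun k => k * δ k) R
  simp only [β, γ, δ, mk_choose, mk_mul_choose] at h0 h1 h2 h3
  have hW : coeff R (X * (1 + X : ℝ⟦X⟧) ^ (A + (i + 1 + e) + i)) =
      ((A + (i + 1 + e) + i).choose (i + 1 + e + i + j) : ℝ) :=
    coeff_X_mul_one_add_X_pow (by omega)
  have e0 : (1 + X : ℝ⟦X⟧) ^ (i + 1) * ((1 + X) ^ (i + 1) * ((1 + X) ^ e * (1 + X) ^ A)) =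
      (1 + X) ^ (A + 1 + (i + 1 + e) + i) := by ring
  have e1 : C ((i + 1 : ℕ) : ℝ) * (X * (1 + X) ^ (i + 1 - 1)) *
      ((1 + X) ^ (i + 1) * ((1 + X) ^ e * (1 + X) ^ A)) =
      C ((i + 1 : ℕ) : ℝ) * (X * (1 + X : ℝ⟦X⟧) ^ (A + (i + 1 + e) + i)) := by
    rw [Nat.add_sub_cancel]; ring
  have e2 : (1 + X) ^ (i + 1) * (C ((i + 1 : ℕ) : ℝ) * (X * (1 + X) ^ (i + 1 - 1)) *
      ((1 + X) ^ e * (1 + X) ^ A)) =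
      C ((i + 1 : ℕ) : ℝ) * (X * (1 + X : ℝ⟦X⟧) ^ (A + (i + 1 + e) + i)) := by
    rw [Nat.add_sub_cancel]; ring
  have e3 : (1 + X) ^ (i + 1) * ((1 + X) ^ (i + 1) *
      ((1 + X) ^ e * (C (A : ℝ) * (X * (1 + X) ^ (A - 1))))) =
      C (A : ℝ) * (X * (1 + X : ℝ⟦X⟧) ^ (A + (i + 1 + e) + i)) := by
    cases A with
    | zero => simp
    | succ A => rw [Nat.add_sub_cancel]; ring
  rw [e0, coeff_one_add_X_pow_symm (d := i + 1 + e + i + j) (e := i + 1 + e + i + j)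
    (by omega) rfl] at h0
  rw [e1, coeff_C_mul, hW] at h1
  rw [e2, coeff_C_mul, hW] at h2
  rw [e3, coeff_C_mul, hW] at h3
  push_cast at h1 h2
  have H := congrArg₂ (· + ·) h3 (congrArg (c * ·)
    (congrArg₂ (· + ·) (congrArg (2 * (j : ℝ) * ·) h0) (congrArg₂ (· + ·) h1 h2)))
  simp only [mul_sum, ← sum_add_distrib] at H
  refine Eq.trans ?_ (H.trans (by ring))
  refine sum_congr rfl fun p _ => sum_congr rfl fun q _ => sum_congr rfl fun w _ => ?_
  ring

/-- The sum over all ways of writing the number `K + 1` of runs as `(i + 1) + j`. The two terms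
with coefficient `c` combine, by absorption and Pascal's rule, into a single sum of the form in
`sum_choose_nanjundiah`. -/
theorem sum_choose_weighted (A B K : ℕ) (c : ℝ) :
    ∑ p ∈ antidiagonal K, ((K + 1).choose p.2 : ℝ) * B.choose p.1 *
        (A * (A + (B + 1) + p.1).choose (B + 1 + K) +
          c * (2 * p.2 * (A + 1 + (B + 1) + p.1).choose (B + 1 + K) +
            2 * (p.1 + 1) * (A + (B + 1) + p.1).choose (B + 1 + K))) =
      (A + (B + 1)).choose (B + 1) *
        (A * (A + B).choose K + 2 * c * (K + 1) * (A + (B + 1)).choose K) := by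
  have h1 := sum_choose_nanjundiah B 1 K A
  have h2 := sum_choose_nanjundiah (B + 1) 0 K A
  simp only [add_zero, add_comm (B + 1) A, add_comm B A] at h1 h2
  have h3 : ∑ p ∈ antidiagonal K, B.choose p.1 *
      (p.2 * (K + 1).choose p.2 * (A + 1 + (B + 1) + p.1).choose (B + 1 + K) +
        (p.1 + 1) * (K + 1).choose p.2 * (A + (B + 1) + p.1).choose (B + 1 + K)) =
      (K + 1) * ∑ p ∈ antidiagonal K, (B + 1).choose p.1 * K.choose p.2 *
        (A + (B + 1) + p.1).choose (B + 1 + K) := by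
    -- absorption: `(i + 1) * (i + j + 1).choose j = (i + j + 1) * (i + j).choose j`
    have hsym : ∀ p ∈ antidiagonal K, B.choose p.1 *
        ((p.1 + 1) * (K + 1).choose p.2 * (A + (B + 1) + p.1).choose (B + 1 + K)) =
        (K + 1) * (B.choose p.1 * K.choose p.2 * (A + (B + 1) + p.1).choose (B + 1 + K)) := by
      rintro ⟨i, j⟩ hp
      obtain rfl : i + j = K := by simpa using hp
      have := Nat.add_one_mul_choose_eq (i + j) i
      rw [Nat.choose_symm_add (a := i) (b := j), show i + j + 1 = i + 1 + j by omega,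
        Nat.choose_symm_add (a := i + 1) (b := j)] at this
      rw [show i + j + 1 = i + 1 + j by omega]
      dsimp only
      linear_combination B.choose i * (A + (B + 1) + i).choose (B + 1 + (i + j)) * this.symm
    simp only [mul_add, sum_add_distrib]
    rw [sum_congr rfl hsym, ← mul_sum]
    cases K with
    | zero => simp
    | succ K =>
      have hsh : ∀ j, (j + 1) * (K + 1 + 1).choose (j + 1) = (K + 1 + 1) * (K + 1).choose j :=
        fun j => by have := Nat.add_one_mul_choose_eq (K + 1) j; linarith
      rw [Nat.sum_antidiagonal_succ' (n := K) (f := fun p =>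
        B.choose p.1 * (p.2 * (K + 1 + 1).choose p.2 *
          (A + 1 + (B + 1) + p.1).choose (B + 1 + (K + 1)))),
        Nat.sum_antidiagonal_succ (n := K), Nat.sum_antidiagonal_succ (n := K)]
      have hfst : ∑ p ∈ antidiagonal K, B.choose p.1 * ((p.2 + 1) * (K + 1 + 1).choose (p.2 + 1) *
          (A + 1 + (B + 1) + p.1).choose (B + 1 + (K + 1))) =
          (K + 1 + 1) * ∑ p ∈ antidiagonal K, B.choose p.1 * (K + 1).choose p.2 *
            (A + (B + 1) + (p.1 + 1)).choose (B + 1 + (K + 1)) := by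
        rw [mul_sum]
        refine sum_congr rfl fun p _ => ?_
        rw [hsh, show A + 1 + (B + 1) + p.1 = A + (B + 1) + (p.1 + 1) by omega]
        ring
      have hpascal : ∑ p ∈ antidiagonal K, (B + 1).choose (p.1 + 1) * (K + 1).choose p.2 *
            (A + (B + 1) + (p.1 + 1)).choose (B + 1 + (K + 1)) =
          ∑ p ∈ antidiagonal K, B.choose p.1 * (K + 1).choose p.2 *
            (A + (B + 1) + (p.1 + 1)).choose (B + 1 + (K + 1)) +
          ∑ p ∈ antidiagonal K, B.choose (p.1 + 1) * (K + 1).choose p.2 *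
            (A + (B + 1) + (p.1 + 1)).choose (B + 1 + (K + 1)) := by
        rw [← sum_add_distrib]
        exact sum_congr rfl fun p _ => by rw [Nat.choose_succ_succ B]; ring
      rw [hfst, hpascal]
      simp only [Nat.choose_zero_right]
      ring
  rw [h2] at h3
  have h1' := congrArg (Nat.cast : ℕ → ℝ) h1
  have h3' := congrArg (Nat.cast : ℕ → ℝ) h3
  push_cast at h1' h3'
  have H := congrArg₂ (· + ·) (congrArg ((A : ℝ) * ·) h1') (congrArg (2 * c * ·) h3')
  simp only [mul_sum, ← sum_add_distrib] at H
  refine Eq.trans ?_ (H.trans (by ring))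
  exact sum_congr rfl fun p _ => by ring

/-! ### Parametrization of the feasible set -/

theorem binom_eq {n k : ℤ} {n' k' : ℕ} (hn : n = n') (hk : k = k') :
    binom n k = n'.choose k' := by
  subst hn hk
  simp [binom]

theorem binom_ne_zero {n k : ℤ} (h : binom n k ≠ 0) : 0 ≤ k ∧ k ≤ n := by
  unfold binom at h
  split_ifs at h with hnk
  · have := Nat.choose_ne_zero_iff.1 (Nat.cast_ne_zero.1 h)
    omega
  · exact absurd rfl h

/-- The weight in the new variables, at `s = N - i`, that is `m = i + 1`. -/
theorem term_eq {A B N i n₁ n₂ n₃ n₄ l₀ : ℕ} (hi : i ≤ N) (hB : i ≤ B)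
    (h : n₁ + n₂ + n₃ + n₄ + l₀ = A + 1) (h₂ : n₂ ≤ i + 1) :
    term ((A + 1 + (B + 1) + (N + 1) : ℕ) : ℤ) ((A + 1 + (B + 1) : ℕ) : ℤ) ((A + 1 : ℕ) : ℤ) l₀
        ((n₁ + n₃ : ℕ) : ℤ) ((n₁ + n₂ : ℕ) : ℤ) ((i + 1 - n₂ : ℕ) : ℤ) ((N : ℤ) - i) =
      (N + 1).choose (i + 1) * B.choose i /
          ((B + 1 + N).choose N * (A + B + N + 2).choose (A + 1)) *
        ((N - i).choose n₁ * ((i + 1).choose n₂ * (i + 1).choose n₃ *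
          (B + 1 - (i + 1)).choose n₄ * A.choose l₀)) := by
  unfold term
  dsimp only
  rw [binom_eq (n' := N + 1) (k' := N - i) (by omega) (by omega),
    binom_eq (n' := B + 1 + N) (k' := N) (by omega) (by omega),
    binom_eq (n' := B) (k' := i) (by omega) (by omega),
    binom_eq (n' := N - i) (k' := n₁) (by omega) (by omega),
    binom_eq (n' := i + 1) (k' := n₂) (by omega) (by omega),
    binom_eq (n' := i + 1) (k' := n₃) (by omega) (by omega),
    binom_eq (n' := B + 1 - (i + 1)) (k' := n₄) (by omega) (by omega),
    binom_eq (n' := A) (k' := l₀) (by omega) (by omega),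
    binom_eq (n' := A + B + N + 2) (k' := A + 1) (by omega) (by omega),
    ← Nat.choose_symm_of_eq_add (show N + 1 = (i + 1) + (N - i) by omega)]
  ring

theorem collision_eq {F : ℕ} {i n₁ n₂ n₃ l₀ : ℕ} (a : ℝ) (hF : 0 < F) (h₂ : n₂ ≤ i + 1) :
    collision F a l₀ ((n₁ + n₃ : ℕ) : ℝ) ((n₁ + n₂ : ℕ) : ℝ) ((i + 1 - n₂ : ℕ) : ℝ) =
      (l₀ + a / F * (2 * n₁ + n₂ + n₃)) / (F + (i + n₁ + 1)) := by
  have h1 : (0 : ℝ) < F := by exact_mod_cast hF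
  unfold collision
  push_cast [Nat.cast_sub h₂]
  rw [show (F : ℝ) + (n₁ + n₂) + (i + 1 - n₂) = F + (i + n₁ + 1) by ring]
  have : (F : ℝ) + (i + n₁ + 1) ≠ 0 := by positivity
  field_simp
  ring

/-- The sum over the feasible set for `s = N - i`, in the variables `n₁, n₂, n₃, n₄, l₀`. The
substitution is `l₂ = n₁ + n₃`, `g₀ = n₁ + n₂`, `g₁ = i + 1 - n₂`; where the binomial
coefficients do not vanish, the intrinsic constraints hold. -/
theorem sum_feasible (A B N i : ℕ) (hi : i ≤ N) (hB : i ≤ B) :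
    ∑ p ∈ feasible (A + 1 + (B + 1) + (N + 1)) (A + 1 + (B + 1)) (A + 1),
      collision ((A + 1 + (B + 1) : ℕ) : ℝ) ((A + 1 : ℕ) : ℝ) p.1 p.2.1 p.2.2.1 p.2.2.2 *
        term ((A + 1 + (B + 1) + (N + 1) : ℕ) : ℤ) ((A + 1 + (B + 1) : ℕ) : ℤ) ((A + 1 : ℕ) : ℤ)
          p.1 p.2.1 p.2.2.1 p.2.2.2 ((N : ℤ) - i) =
    (N + 1).choose (i + 1) * B.choose i /
        ((B + 1 + N).choose N * (A + B + N + 2).choose (A + 1)) *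
      ∑ o ∈ antidiagonal (A + 1),
        (N - i).choose o.1 / (((A + 1 + (B + 1) : ℕ) : ℝ) + (i + o.1 + 1)) *
          ∑ p ∈ antidiagonal o.2, ∑ q ∈ antidiagonal p.2, ∑ w ∈ antidiagonal q.2,
            ((i + 1).choose p.1 : ℝ) * (i + 1).choose q.1 * (B + 1 - (i + 1)).choose w.1 *
              A.choose w.2 * (w.2 + ((A + 1 : ℕ) : ℝ) / ((A + 1 + (B + 1) : ℕ) : ℝ) *
                (2 * o.1 + p.1 + q.1)) := by
  simp only [mul_sum, sum_sigma']
  symm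
  refine sum_bij_ne_zero
    (fun t _ _ => (t.2.2.2.2, t.1.1 + t.2.2.1.1, t.1.1 + t.2.1.1, i + 1 - t.2.1.1)) ?_ ?_ ?_ ?_
  · rintro ⟨⟨n₁, R⟩, ⟨n₂, R₂⟩, ⟨n₃, R₃⟩, ⟨n₄, l₀⟩⟩ ht h0
    simp only [mem_sigma, HasAntidiagonal.mem_antidiagonal] at ht
    simp only [ne_eq, mul_eq_zero, div_eq_zero_iff, not_or, Nat.cast_eq_zero,
      Nat.choose_eq_zero_iff, not_lt] at h0
    dsimp only
    rw [mem_feasible]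
    refine ⟨n₂ + n₄, N + 1 - (i + 1) - n₁, n₃ + n₄, B + 1 - n₄ - (i + 1), i + 1 - n₃, ?_⟩
    constructor <;> omega
  · rintro ⟨⟨n₁, R⟩, ⟨n₂, R₂⟩, ⟨n₃, R₃⟩, ⟨n₄, l₀⟩⟩ ht h0
      ⟨⟨n₁', R'⟩, ⟨n₂', R₂'⟩, ⟨n₃', R₃'⟩, ⟨n₄', l₀'⟩⟩ ht' h0' he
    simp only [mem_sigma, HasAntidiagonal.mem_antidiagonal] at ht ht'
    simp only [ne_eq, mul_eq_zero, div_eq_zero_iff, not_or, Nat.cast_eq_zero,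
      Nat.choose_eq_zero_iff, not_lt] at h0 h0'
    simp only [Prod.mk.injEq] at he
    obtain rfl : n₂ = n₂' := by omega
    obtain rfl : n₁ = n₁' := by omega
    obtain rfl : n₃ = n₃' := by omega
    obtain rfl : l₀ = l₀' := by omega
    obtain rfl : R = R' := by omega
    obtain rfl : R₂ = R₂' := by omega
    obtain rfl : R₃ = R₃' := by omega
    obtain rfl : n₄ = n₄' := by omega
    rfl
  · rintro ⟨l₀, l₂, g₀, g₁⟩ hp h0
    obtain ⟨l₁, g₂, h₀, h₁, h₂, hc⟩ := mem_feasible.1 hp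
    obtain ⟨c1, c2, c3, c4, c5, c6⟩ := hc
    have ht := right_ne_zero_of_mul h0
    unfold term at ht
    dsimp only at ht
    simp only [ne_eq, mul_eq_zero, div_eq_zero_iff, not_or] at ht
    obtain ⟨-, ⟨⟨⟨⟨⟨t0, t1⟩, t2⟩, t3⟩, t4⟩, t5⟩, -⟩ := ht
    have b1 := binom_ne_zero t1
    have b2 := binom_ne_zero t2
    have b3 := binom_ne_zero t3
    have b4 := binom_ne_zero t4
    have b5 := binom_ne_zero t5
    obtain ⟨n₁, e1⟩ := Int.eq_ofNat_of_zero_le b1.1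
    obtain ⟨n₂, e2⟩ := Int.eq_ofNat_of_zero_le b2.1
    obtain ⟨n₃, e3⟩ := Int.eq_ofNat_of_zero_le b3.1
    obtain ⟨n₄, e4⟩ := Int.eq_ofNat_of_zero_le b4.1
    have s2 : n₂ ≤ i + 1 := by omega
    have hl₂ : l₂ = n₁ + n₃ := by omega
    have hg₀ : g₀ = n₁ + n₂ := by omega
    have hg₁ : g₁ = i + 1 - n₂ := by omega
    have hsum : n₁ + n₂ + n₃ + n₄ + l₀ = A + 1 := by omega
    subst hl₂ hg₀ hg₁
    refine ⟨⟨(n₁, n₂ + n₃ + n₄ + l₀), (n₂, n₃ + n₄ + l₀), (n₃, n₄ + l₀), (n₄, l₀)⟩, ?_, ?_, rfl⟩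
    · simp only [mem_sigma, HasAntidiagonal.mem_antidiagonal, and_true]
      omega
    · dsimp only at h0 ⊢
      rw [term_eq hi hB hsum s2, collision_eq _ (by omega) s2] at h0
      intro h; apply h0; rw [← h]; ring
  · rintro ⟨⟨n₁, R⟩, ⟨n₂, R₂⟩, ⟨n₃, R₃⟩, ⟨n₄, l₀⟩⟩ ht h0
    simp only [mem_sigma, HasAntidiagonal.mem_antidiagonal] at ht
    simp only [ne_eq, mul_eq_zero, div_eq_zero_iff, not_or, Nat.cast_eq_zero,
      Nat.choose_eq_zero_iff, not_lt] at h0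
    have s2 : n₂ ≤ i + 1 := by omega
    dsimp only
    rw [term_eq (n₄ := n₄) hi hB (by omega) s2, collision_eq _ (by omega) s2]
    ring

/-- The variable `K` is the number of runs minus one. -/
theorem Etilde_eq_sum (A B N : ℕ) :
    Etilde (A + 1 + (B + 1)) (A + 1) (A + 1 + (B + 1) + (N + 1)) =
      ((B + 1 + N).choose N * (A + B + N + 2).choose (A + 1) : ℝ)⁻¹ *
        ∑ K ∈ range (N + 1), (N + 1).choose (K + 1) / (((A + 1 + (B + 1) : ℕ) : ℝ) + (K + 1)) *
          ((A + (B + 1)).choose (B + 1) * (A * (A + B).choose K +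
            2 * (((A + 1 : ℕ) : ℝ) / ((A + 1 + (B + 1) : ℕ) : ℝ)) * (K + 1) *
              (A + (B + 1)).choose K)) := by
  set F : ℝ := ((A + 1 + (B + 1) : ℕ) : ℝ) with hF
  set c : ℝ := ((A + 1 : ℕ) : ℝ) / F with hc
  set Z : ℝ := ((B + 1 + N).choose N * (A + B + N + 2).choose (A + 1) : ℝ) with hZ
  let G : ℕ → ℕ → ℝ := fun i j => A * (A + (B + 1) + i).choose (B + 1 + i + j) +
        c * (2 * j * (A + 1 + (B + 1) + i).choose (B + 1 + i + j) +
          2 * (i + 1) * (A + (B + 1) + i).choose (B + 1 + i + j))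
  let T : ℕ → ℕ → ℝ := fun i j => (N + 1).choose (i + 1) * B.choose i * (N - i).choose j /
    (F + (i + j + 1)) * G i j
  have hinner : ∀ i, i ≤ N → i ≤ B →
      ∑ p ∈ feasible (A + 1 + (B + 1) + (N + 1)) (A + 1 + (B + 1)) (A + 1),
        collision F ((A + 1 : ℕ) : ℝ) p.1 p.2.1 p.2.2.1 p.2.2.2 *
          term ((A + 1 + (B + 1) + (N + 1) : ℕ) : ℤ) ((A + 1 + (B + 1) : ℕ) : ℤ) ((A + 1 : ℕ) : ℤ)
            p.1 p.2.1 p.2.2.1 p.2.2.2 ((N : ℤ) - i) =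
      Z⁻¹ * ∑ j ∈ range (N + 1 - i), T i j := by
    intro i hi hB
    rw [sum_feasible A B N i hi hB]
    trans Z⁻¹ * ∑ o ∈ antidiagonal (A + 1), T i o.1
    · rw [mul_sum, mul_sum]
      refine sum_congr rfl fun o ho => ?_
      rw [sum_vandermonde_weighted A (B + 1) i o.1 o.2 _ (by omega)
        (HasAntidiagonal.mem_antidiagonal.1 ho)]
      simp only [T, G]
      ring
    -- the summands vanish for `j > A + 1` and for `j > N - i`
    · congr 1
      rw [Nat.sum_antidiagonal_eq_sum_range_succ_mk]
      dsimp only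
      rcases le_total (A + 1).succ (N + 1 - i) with hle | hle
      · refine sum_subset (range_mono hle) fun j _ hj => ?_
        rw [mem_range] at hj
        simp only [T, G]
        rw [Nat.choose_eq_zero_of_lt (show A + (B + 1) + i < B + 1 + i + j by omega),
          Nat.choose_eq_zero_of_lt (show A + 1 + (B + 1) + i < B + 1 + i + j by omega)]
        simp
      · symm
        refine sum_subset (range_mono hle) fun j _ hj => ?_
        rw [mem_range] at hj
        simp only [T]
        rw [Nat.choose_eq_zero_of_lt (show N - i < j by omega)]
        simp
  unfold Etilde weight
  rw [if_neg (by omega)]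
  simp only [mul_sum]
  rw [sum_comm]
  trans ∑ i ∈ range (N + 1), Z⁻¹ * ∑ j ∈ range (N + 1 - i), T i j
  · symm
    trans ∑ i ∈ range (N + 1) with i ≤ B, Z⁻¹ * ∑ j ∈ range (N + 1 - i), T i j
    · symm
      refine sum_subset (filter_subset _ _) fun i hi hiB => ?_
      rw [mem_filter, not_and] at hiB
      refine mul_eq_zero_of_right _ (sum_eq_zero fun j _ => ?_)
      simp only [T]
      rw [Nat.choose_eq_zero_of_lt (not_le.1 (hiB hi))]
      simp
    -- the substitution `s = N - i`; the lower bound for `s` is `i ≤ B`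
    · refine sum_bij (fun i _ => (N : ℤ) - i) ?_ ?_ ?_ ?_
      · intro i hi
        simp only [mem_filter, mem_range, mem_Icc] at hi ⊢
        omega
      · intro i _ j _ h
        omega
      · intro s hs
        simp only [mem_Icc] at hs
        refine ⟨((N : ℤ) - s).toNat, ?_, by omega⟩
        simp only [mem_filter, mem_range]
        omega
      · intro i hi
        simp only [mem_filter, mem_range] at hi
        exact (hinner i (by omega) hi.2).symm
  · rw [← mul_sum, ← mul_sum, ← sum_range_diag_flip]
    congr 1
    refine sum_congr rfl fun K hK => ?_
    rw [← sum_choose_weighted, mul_sum, Nat.sum_antidiagonal_eq_sum_range_succ_mk]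
    refine sum_congr rfl fun i hi => ?_
    rw [mem_range] at hK hi
    obtain ⟨j, rfl⟩ := Nat.exists_eq_add_of_le (show i ≤ K by omega)
    have hch : ((N + 1).choose (i + 1) * (N - i).choose j : ℝ) =
        (N + 1).choose (i + j + 1) * (i + j + 1).choose j := by
      have := Nat.choose_mul (n := N + 1) (k := i + j + 1) (s := i + 1) (by omega)
      rw [show N + 1 - (i + 1) = N - i by omega, show i + j + 1 - (i + 1) = j by omega,
        show i + j + 1 = i + 1 + j by omega, Nat.choose_symm_add] at this
      rw [show i + j + 1 = i + 1 + j by omega]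
      exact_mod_cast this.symm
    simp only [T, G]
    rw [show i + j - i = j by omega, show B + 1 + (i + j) = B + 1 + i + j by omega]
    push_cast
    linear_combination (B.choose i : ℝ) / (F + (i + j + 1)) * G i j * hch

/-! ### Conditioning on the number of runs -/

/-- The conditional expectation of `collision` given that the `-` points form exactly `k` runs:
the non-`-` points are then in uniformly random circular order, and the runs occupy a uniformly
random set of `k` of the `f` gaps between them. The number of runs is real here, so that the
degenerate dimension `D = f` is the value at `k = 0`. -/
noncomputable def condCollision (f a k : ℝ) : ℝ :=
  a / (f * (f + k)) * ((a - 1) * (f - k) / (f - 1) + 2 * a * k / f)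

/-- The probability that `N + 1` points `-`, inserted into the `f` gaps of a circular arrangement,
form exactly `K + 1` runs. Both counts are shifted by one since at least one `-` is present. -/
noncomputable def runProb (f N K : ℕ) : ℝ :=
  f.choose (K + 1) * N.choose K / (f + N).choose (N + 1)

theorem cast_choose_succ_mul (n k : ℕ) :
    (n.choose (k + 1) : ℝ) * (k + 1) = n.choose k * (n - k) := by
  rcases le_or_gt k n with h | h
  · rw [← Nat.cast_sub h]
    exact_mod_cast Nat.choose_succ_right_eq n k
  · rw [Nat.choose_eq_zero_of_lt h, Nat.choose_eq_zero_of_lt (by omega)]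
    simp

theorem cast_succ_mul_choose (n k : ℕ) :
    ((n + 1).choose (k + 1) : ℝ) * (k + 1) = (n + 1) * n.choose k := by
  exact_mod_cast (Nat.add_one_mul_choose_eq n k).symm

theorem cast_choose_ne_zero {n k : ℕ} (h : k ≤ n) : (n.choose k : ℝ) ≠ 0 :=
  Nat.cast_ne_zero.2 (Nat.choose_pos h).ne'

theorem condCollision_add_one_sub {f a k : ℝ} (hf : 1 < f) (hk : 0 ≤ k) :
    condCollision f a (k + 1) - condCollision f a k =
      2 * a * (f - a) / (f * (f - 1) * (f + k) * (f + k + 1)) := by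
  have h1 : f - 1 ≠ 0 := by linarith
  have h2 : f ≠ 0 := by linarith
  have h3 : f + k ≠ 0 := by linarith
  have h4 : f + k + 1 ≠ 0 := by linarith
  unfold condCollision
  rw [show f + (k + 1) = f + k + 1 by ring]
  field_simp
  ring

theorem condCollision_lt {f a k : ℝ} (ha : 0 < a) (haf : a < f) (hf : 1 < f) (hk : 0 ≤ k) :
    condCollision f a k < condCollision f a (k + 1) := by
  rw [← sub_pos, condCollision_add_one_sub hf hk]
  have h1 : 0 < f - 1 := by linarith
  have h2 : 0 < f - a := by linarith
  positivity

/-- The constant that turns the normalization of the weights into that of `runProb`. -/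
theorem choose_normalization (A B N : ℕ) :
    ((B + 1 + N).choose N * (A + B + N + 2).choose (A + 1) * (A + 1) : ℝ) =
      (A + (B + 1)).choose (B + 1) * ((N + 1) * (A + 1 + (B + 1) + N).choose (N + 1)) := by
  have e1 : ((B + 1 + N).choose N : ℝ) =
      (B + 1 + N).factorial / ((B + 1).factorial * N.factorial) := by
    rw [← Nat.choose_symm_add, Nat.cast_add_choose]
  have e2 : ((A + B + N + 2).choose (A + 1) : ℝ) =
      (A + B + N + 2).factorial / ((A + 1).factorial * (B + 1 + N).factorial) := by
    rw [show A + B + N + 2 = A + 1 + (B + 1 + N) by omega, Nat.cast_add_choose]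
  have e3 : ((A + (B + 1)).choose (B + 1) : ℝ) =
      (A + (B + 1)).factorial / (A.factorial * (B + 1).factorial) := by
    rw [← Nat.choose_symm_add, Nat.cast_add_choose]
  have e4 : ((A + 1 + (B + 1) + N).choose (N + 1) : ℝ) =
      (A + B + N + 2).factorial / ((A + (B + 1)).factorial * (N + 1).factorial) := by
    rw [show A + 1 + (B + 1) + N = A + (B + 1) + (N + 1) by omega, ← Nat.choose_symm_add,
      Nat.cast_add_choose, show A + (B + 1) + (N + 1) = A + B + N + 2 by omega]
  rw [e1, e2, e3, e4, Nat.factorial_succ A, Nat.factorial_succ N]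
  have h : ∀ n : ℕ, (n.factorial : ℝ) ≠ 0 := fun n => by exact_mod_cast n.factorial_ne_zero
  have h1 := h (B + 1 + N)
  have h2 := h (B + 1)
  have h3 := h N
  have h4 := h A
  have h5 := h (A + (B + 1))
  have h6 : (A : ℝ) + 1 ≠ 0 := by positivity
  have h7 : (N : ℝ) + 1 ≠ 0 := by positivity
  push_cast
  field_simp

theorem Etilde_eq_sum_runProb {f a : ℕ} (ha : 0 < a) (haf : a < f) (N : ℕ) :
    Etilde f a (f + (N + 1)) =
      ∑ K ∈ range (N + 1), runProb f N K * condCollision f a (K + 1) := by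
  obtain ⟨A, rfl⟩ := Nat.exists_eq_succ_of_ne_zero ha.ne'
  obtain ⟨B, rfl⟩ := Nat.exists_eq_add_of_lt haf
  simp only [Nat.succ_eq_add_one, show A + 1 + B + 1 = A + 1 + (B + 1) by omega]
  rw [Etilde_eq_sum, mul_sum]
  refine sum_congr rfl fun K _ => ?_
  have h1 := cast_choose_succ_mul (A + B + 1) K
  have h2 := cast_succ_mul_choose N K
  have h3 := cast_succ_mul_choose (A + (B + 1)) K
  have h4 := cast_succ_mul_choose (A + B) K
  have h5 := choose_normalization A B N
  have hZ : ((B + 1 + N).choose N * (A + B + N + 2).choose (A + 1) : ℝ) ≠ 0 :=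
    mul_ne_zero (cast_choose_ne_zero (by omega)) (cast_choose_ne_zero (by omega))
  have hQ : ((A + 1 + (B + 1) + N).choose (N + 1) : ℝ) ≠ 0 :=
    cast_choose_ne_zero (by omega)
  rw [show A + 1 + (B + 1) = A + (B + 1) + 1 by omega] at hQ h5 ⊢
  rw [show A + (B + 1) = A + B + 1 by omega] at h3 hQ h5 ⊢
  unfold runProb condCollision
  set Z : ℝ := ((B + 1 + N).choose N * (A + B + N + 2).choose (A + 1) : ℝ)
  set Q : ℝ := ((A + B + 1 + 1 + N).choose (N + 1) : ℝ)
  set x : ℝ := ((A + B + 1).choose K : ℝ)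
  have hx : ((A + B).choose K : ℝ) = x * (A + B + 1 - K) / (A + B + 1) := by
    rw [eq_div_iff (by positivity)]
    push_cast at h1 h4
    linear_combination h1 - h4
  have hN : ((N + 1).choose (K + 1) : ℝ) = (N + 1) * N.choose K / (K + 1) := by
    rw [eq_div_iff (by positivity)]; exact h2
  have hF : ((A + B + 1 + 1).choose (K + 1) : ℝ) = (A + B + 2) * x / (K + 1) := by
    rw [eq_div_iff (by positivity)]; push_cast at h3; linear_combination h3
  have hy : ((A + B + 1).choose (B + 1) : ℝ) = Z * (A + 1) / ((N + 1) * Q) := by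
    rw [eq_div_iff (mul_ne_zero (by positivity) hQ)]; exact h5.symm
  rw [hx, hN, hF, hy]
  push_cast
  have p1 : (A : ℝ) + B + 1 ≠ 0 := by positivity
  have p2 : (A : ℝ) + B + 1 + 1 ≠ 0 := by positivity
  have p3 : (A : ℝ) + B + 1 + 1 + (K + 1) ≠ 0 := by positivity
  have p4 : (N : ℝ) + 1 ≠ 0 := by positivity
  have p5 : (K : ℝ) + 1 ≠ 0 := by positivity
  rw [show (A : ℝ) + B + 1 + 1 - 1 = A + B + 1 by ring]
  field_simp
  ring

theorem Etilde_self {f a : ℕ} (haf : a < f) : Etilde f a f = condCollision f a 0 := by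
  have hf : (f : ℝ) ≠ 0 := by
    have : 0 < f := by omega
    positivity
  unfold Etilde condCollision
  rw [if_pos rfl]
  rw [add_zero, sub_zero, mul_zero, zero_div, add_zero]
  field_simp

theorem runProb_nonneg (f N K : ℕ) : 0 ≤ runProb f N K := by
  unfold runProb; positivity

theorem runProb_succ_zero {f : ℕ} (hf : 0 < f) (N : ℕ) :
    (f + N + 1) * runProb f (N + 1) 0 = (N + 2) * runProb f N 0 := by
  have hQ := cast_succ_mul_choose (f + N) (N + 1)
  have q1 := cast_choose_ne_zero (show N + 1 ≤ f + N by omega)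
  have q2 := cast_choose_ne_zero (show N + 1 + 1 ≤ f + N + 1 by omega)
  unfold runProb
  rw [show f + (N + 1) = f + N + 1 by omega]
  simp only [zero_add, Nat.choose_one_right, Nat.choose_zero_right]
  push_cast at hQ ⊢
  rw [mul_div_assoc', mul_div_assoc', div_eq_div_iff q2 q1]
  linear_combination (-f : ℝ) * hQ

/-- A new `-` point falls into an existing run, or else into one of the gaps without `-`. -/
theorem runProb_succ_succ {f : ℕ} (hf : 0 < f) (N K : ℕ) :
    (f + N + 1) * runProb f (N + 1) (K + 1) =
      (N + K + 3) * runProb f N (K + 1) + (f - (K + 1)) * runProb f N K := by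
  have hQ := cast_succ_mul_choose (f + N) (N + 1)
  have q1 := cast_choose_ne_zero (show N + 1 ≤ f + N by omega)
  have q2 := cast_choose_ne_zero (show N + 1 + 1 ≤ f + N + 1 by omega)
  have h1 := cast_choose_succ_mul f (K + 1)
  have h2 := cast_choose_succ_mul N K
  have h3 : ((N + 1).choose (K + 1) : ℝ) = N.choose K + N.choose (K + 1) := by
    exact_mod_cast Nat.choose_succ_succ N K
  unfold runProb
  rw [show f + (N + 1) = f + N + 1 by omega, h3]
  push_cast at hQ h1 ⊢
  rw [mul_div_assoc', mul_div_assoc', mul_div_assoc', ← add_div, div_eq_div_iff q2 q1]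
  linear_combination
    (-f.choose (K + 1 + 1) * (N.choose K + N.choose (K + 1)) : ℝ) * hQ +
    ((f + N + 1).choose (N + 1 + 1) * N.choose K : ℝ) * h1 -
    ((f + N + 1).choose (N + 1 + 1) * f.choose (K + 1 + 1) : ℝ) * h2

/-- One step of the Markov chain of the number of runs: from `K + 1` runs there are `N + K + 2`
gaps next to a `-`, and `f - (K + 1)` other gaps. -/
theorem sum_runProb_succ {f : ℕ} (hf : 0 < f) (N : ℕ) (φ : ℕ → ℝ) :
    (f + N + 1) * ∑ K ∈ range (N + 2), runProb f (N + 1) K * φ K =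
      ∑ K ∈ range (N + 1), runProb f N K *
        ((N + K + 2) * φ K + (f - (K + 1)) * φ (K + 1)) := by
  have hlast : runProb f N (N + 1) = 0 := by simp [runProb]
  have hstay : ∑ K ∈ range (N + 1), runProb f N K * ((N + K + 2) * φ K) =
      runProb f N 0 * ((N + 2) * φ 0) +
        ∑ K ∈ range (N + 1), runProb f N (K + 1) * ((N + K + 3) * φ (K + 1)) := by
    trans ∑ K ∈ range (N + 1 + 1), runProb f N K * ((N + K + 2) * φ K)
    · rw [sum_range_succ _ (N + 1), hlast, zero_mul, add_zero]
    · rw [sum_range_succ', add_comm]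
      congr 1
      · simp
      · refine sum_congr rfl fun K _ => ?_
        push_cast
        ring
  simp only [mul_add (runProb _ _ _), sum_add_distrib]
  rw [hstay, sum_range_succ', mul_add, mul_sum, add_comm (∑ _ ∈ _, _),
    add_assoc (runProb f N 0 * _), ← sum_add_distrib]
  congr 1
  · linear_combination φ 0 * runProb_succ_zero hf N
  · refine sum_congr rfl fun K _ => ?_
    linear_combination φ (K + 1) * runProb_succ_succ hf N K

theorem Etilde_succ_sub {f a : ℕ} (ha : 0 < a) (haf : a < f) (N : ℕ) :
    (f + N + 1) * (Etilde f a (f + (N + 1) + 1) - Etilde f a (f + (N + 1))) =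
      ∑ K ∈ range (N + 1), runProb f N K * ((f - (K + 1)) *
        (condCollision f a (K + 1 + 1) - condCollision f a (K + 1))) := by
  have h := sum_runProb_succ (f := f) (by omega) N fun K => condCollision f a (K + 1)
  rw [show f + (N + 1) + 1 = f + (N + 1 + 1) by omega, Etilde_eq_sum_runProb ha haf,
    Etilde_eq_sum_runProb ha haf, mul_sub, h, mul_sum, ← sum_sub_distrib]
  refine sum_congr rfl fun K _ => ?_
  push_cast
  ring

end CMinHash

theorem lemma3p3 (f a : ℕ) (ha : 0 < a) (haf : a < f) (D : ℕ) (hD : f ≤ D) :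
    CMinHash.Etilde f a D < CMinHash.Etilde f a (D + 1) := by
  have ha' : (0 : ℝ) < a := by exact_mod_cast ha
  have haf' : (a : ℝ) < f := by exact_mod_cast haf
  have hf' : (1 : ℝ) < f := by exact_mod_cast (show 1 < f by omega)
  obtain ⟨n, rfl⟩ := Nat.exists_eq_add_of_le hD
  cases n with
  | zero =>
    have h := CMinHash.condCollision_lt ha' haf' hf' le_rfl
    have hf0 : (f : ℝ) ≠ 0 := by linarith
    rw [add_zero, CMinHash.Etilde_self haf, CMinHash.Etilde_eq_sum_runProb ha haf 0]
    simpa [CMinHash.runProb, hf0] using h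
  | succ N =>
    rw [← sub_pos]
    refine pos_of_mul_pos_right (a := (f : ℝ) + N + 1) ?_ (by positivity)
    rw [CMinHash.Etilde_succ_sub ha haf N]
    have hstep : ∀ K : ℕ, 0 < CMinHash.condCollision f a (K + 1 + 1) -
        CMinHash.condCollision f a (K + 1) := fun K =>
      sub_pos.2 (CMinHash.condCollision_lt ha' haf' hf' (by positivity))
    refine Finset.sum_pos' (fun K _ => ?_) ⟨0, by simp, ?_⟩
    -- for `K + 1 > f` the factor `f - (K + 1)` is negative, but there are at most `f` runs
    · rcases le_or_gt (K + 1) f with hK | hK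
      · have : (0 : ℝ) ≤ f - (K + 1) := by
          rw [sub_nonneg]; exact_mod_cast hK
        exact mul_nonneg (CMinHash.runProb_nonneg f N K) (mul_nonneg this (hstep K).le)
      · have : CMinHash.runProb f N K = 0 := by
          simp [CMinHash.runProb, Nat.choose_eq_zero_of_lt hK]
        rw [this, zero_mul]
    · have h0 : 0 < CMinHash.runProb f N 0 := by
        have := Nat.choose_pos (show N + 1 ≤ f + N by omega)
        simp only [CMinHash.runProb, zero_add, Nat.choose_one_right, Nat.choose_zero_right]
        have : 0 < f := by omega
        positivity
      refine mul_pos h0 (mul_pos ?_ (hstep 0))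
      simpa using hf'
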